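/- Let $n\ge 0$, let $(N,g)$ be a smooth finite-dimensional Riemannian manifold without boundary and let $V\colon N\to\mathbb{R}$ be a smooth function. Let $\phi\colon\mathbb{R}^n\to N$ be a smooth harmonic map with potential $V$, that is, a smooth map satisfying \[ \tau(\phi)=-\nabla V(\phi), \] where $\nabla V$ is the Riemannian gradient of $V$ and $\tau(\phi)=\operatorname{tr}\nabla d\phi$ is the tension field of $\phi$, given in local coordinates of $N$ by $\tau(\phi)^k=\Delta\phi^k+\sum_{i=1}^n\sum_{a,b}\Gamma^k_{ab}(\phi)\,\partial_i\phi^a\,\partial_i\phi^b$ with the Christoffel symbols $\Gamma^k_{ab}$ of the Levi-Civita connection of $g$. Write $|d\phi|^2=\sum_{i=1}^n g(\partial_i\phi,\partial_i\phi)$ and let $B_r(x)$ be the open Euclidean ball of radius $r$ around $x\in\mathbb{R}^n$. Suppose that $V(\phi(y))\le 0$ for all $y\in\mathbb{R}^n$. Then for every $x\in\mathbb{R}^n$ the function \[ r\longmapsto \frac{1}{r^{n-2}}\int_{B_r(x)}\Big(\frac12|d\phi|^2-V(\phi)\Big)\,dy \] is well defined (the integrand is integrable on $B_r(x)$) and differentiable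 on $(0,\infty)$, and \[ \frac{d}{dr}\,\frac{1}{r^{n-2}}\int_{B_r(x)}\Big(\frac12|d\phi|^2-V(\phi)\Big)\,dy\ \ge\ 0\qquad\text{for all } r>0. \] In particular this function is nondecreasing on $(0,\infty)$. -/

import Mathlib

open scoped Manifold ContDiff

noncomputable section

/-- Euclidean space `ℝᵏ` with its standard inner product. -/
abbrev Euc (k : ℕ) : Type := EuclideanSpace ℝ (Fin k)

/-- The `i`-th standard basis vector of `ℝᵏ`. -/
abbrev stdVec {k : ℕ} (i : Fin k) : Euc k := EuclideanSpace.single i (1 : ℝ)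

/-- A smooth Riemannian metric on an `m`-dimensional smooth manifold `N` (without boundary). -/
abbrev SmoothMetric (m : ℕ) (N : Type*) [TopologicalSpace N] [ChartedSpace (Euc m) N]
    [IsManifold (𝓡 m) ∞ N] :=
  Bundle.ContMDiffRiemannianMetric (𝓡 m) ∞ (Euc m) (fun y : N => TangentSpace (𝓡 m) y)

namespace HarmonicMap

section Target

variable {m : ℕ} {N : Type*} [TopologicalSpace N] [ChartedSpace (Euc m) N]
  [IsManifold (𝓡 m) ∞ N]

/-- The coordinate vector field `∂_i` of the preferred chart at `y`, at the point of `N` with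
coordinates `u`. -/
def coordVec (y : N) (u : Euc m) (i : Fin m) :
    TangentSpace (𝓡 m) ((extChartAt (𝓡 m) y).symm u) :=
  mfderiv 𝓘(ℝ, Euc m) (𝓡 m) (extChartAt (𝓡 m) y).symm u (stdVec i)

/-- The matrix `g_{ij} = g(∂_i, ∂_j)` of the metric in the preferred chart at `y`, at the point of
`N` with coordinates `u`. -/
def metricMatrix (g : SmoothMetric m N) (y : N) (u : Euc m) : Matrix (Fin m) (Fin m) ℝ :=
  Matrix.of fun i j =>
    g.inner ((extChartAt (𝓡 m) y).symm u) (coordVec y u i) (coordVec y u j)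

/-- The partial derivative `∂_k g_{ij}` in the preferred chart at `y`. -/
def metricDeriv (g : SmoothMetric m N) (y : N) (u : Euc m) (k i j : Fin m) : ℝ :=
  fderiv ℝ (fun w : Euc m => metricMatrix g y w i j) u (stdVec k)

/-- The Christoffel symbols of the Levi-Civita connection in the preferred chart at `y`:
`Γ^k_{ij} = ½ ∑_l g^{kl} (∂_i g_{jl} + ∂_j g_{il} - ∂_l g_{ij})`. -/
def christoffel (g : SmoothMetric m N) (y : N) (u : Euc m) (k i j : Fin m) : ℝ :=
  (1 / 2) * ∑ l, (metricMatrix g y u)⁻¹ k l *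
    (metricDeriv g y u i j l + metricDeriv g y u j i l - metricDeriv g y u l i j)

/-- The Riemannian gradient of `V : N → ℝ`, with components `(∇V)^k = ∑_l g^{kl} ∂_l V`. Here, as
everywhere below, an element of the tangent space at `y` is given by its components in the
preferred chart at `y`; this is how `TangentSpace` is defined. -/
def riemGradient (g : SmoothMetric m N) (V : N → ℝ) (y : N) : TangentSpace (𝓡 m) y :=
  WithLp.toLp 2 fun k : Fin m =>
    ∑ l, (metricMatrix g y (extChartAt (𝓡 m) y y))⁻¹ k l *
      fderiv ℝ (V ∘ (extChartAt (𝓡 m) y).symm) (extChartAt (𝓡 m) y y) (stdVec l)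

end Target

section Maps

variable {n m : ℕ} {N : Type*} [TopologicalSpace N] [ChartedSpace (Euc m) N]
  [IsManifold (𝓡 m) ∞ N]

/-- `|dφ|² = ∑_i g(dφ(e_i), dφ(e_i))` for the standard orthonormal basis `e_i` of `ℝⁿ`. -/
def normSqDiff (g : SmoothMetric m N) (φ : Euc n → N) (x : Euc n) : ℝ :=
  ∑ i : Fin n, g.inner (φ x) (mfderiv (𝓡 n) (𝓡 m) φ x (stdVec i))
    (mfderiv (𝓡 n) (𝓡 m) φ x (stdVec i))

/-- The expression of `φ : ℝⁿ → N` in the preferred chart at `φ x`. -/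
def localRep (φ : Euc n → N) (x : Euc n) : Euc n → Euc m :=
  fun z => extChartAt (𝓡 m) (φ x) (φ z)

/-- The tension field `τ(φ) = tr ∇dφ = ∑_i (∇dφ)(e_i, e_i)` of a map `φ : ℝⁿ → N`. Its value at `x`
is the tangent vector at `φ x` whose components in the preferred chart at `φ x` are
`τ^k = Δφ^k + ∑_i ∑_{a,b} Γ^k_{ab}(φ) ∂_i φ^a ∂_i φ^b`. -/
def tensionField (g : SmoothMetric m N) (φ : Euc n → N) (x : Euc n) :
    TangentSpace (𝓡 m) (φ x) :=
  WithLp.toLp 2 fun k : Fin m =>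
    Laplacian.laplacian (fun z => localRep φ x z k) x +
      ∑ i : Fin n, ∑ a : Fin m, ∑ b : Fin m,
        christoffel g (φ x) (extChartAt (𝓡 m) (φ x) (φ x)) k a b *
          fderiv ℝ (fun z => localRep φ x z a) x (stdVec i) *
          fderiv ℝ (fun z => localRep φ x z b) x (stdVec i)

/-- Smooth harmonic maps with potential `V` from `ℝⁿ` to `(N, g)`: smooth maps `φ` with
`τ(φ) = -∇V(φ)`. -/
structure IsHarmonicWithPotential (g : SmoothMetric m N) (V : N → ℝ) (φ : Euc n → N) : Prop where
  smooth : ContMDiff (𝓡 n) (𝓡 m) ∞ φ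
  equation : ∀ x, tensionField g φ x = -riemGradient g V (φ x)

/-- The energy density `½|dφ|² - V(φ)`. -/
def energyDensity (g : SmoothMetric m N) (V : N → ℝ) (φ : Euc n → N) (x : Euc n) : ℝ :=
  (1 / 2) * normSqDiff g φ x - V (φ x)

/-- The scaled energy `r^{-(n-2)} ∫_{B_r(x)} (½|dφ|² - V(φ))`. -/
def scaledEnergy (g : SmoothMetric m N) (V : N → ℝ) (φ : Euc n → N) (x : Euc n) (r : ℝ) : ℝ :=
  1 / r ^ ((n : ℤ) - 2) * ∫ y in Metric.ball x r, energyDensity g V φ y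

end Maps

end HarmonicMap

end

/-! Let `e = ½|dφ|² - V(φ)` and `T_ij = g(∂_i φ, ∂_j φ)`. The harmonic map equation with potential
gives the conservation law `∂_j e = ∑_i ∂_i T_ij` (`fderiv_energyDensity`). Contracting `T` with the
position field yields `X_i = ∑_j T_ij (y - x)_j`, and since `tr T = |dφ|² = 2e + 2V(φ)`, `div X = 2e
+ de(y - x) + 2V(φ)` (`divergence_radialStress`).

The substitution `y = x + rz` turns the scaled energy into `r² ∫_{B_1} e(x + rz) dz`, whose
derivative is `r^{1-n} ∫_{B_r} (2e + de(y - x))` (`hasDerivAt_scaled_integral_ball`). That integrand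
equals `div X - 2V(φ) ≥ div X`. Finally `∫_{B_r} div X ≥ 0`: morally it is the flux of `X` through
the sphere, and the radial part of `X` is a multiple of `|dφ(y - x)|² ≥ 0`. Pairing with radial
cutoffs and passing to the limit (`integral_ball_divergence_nonneg`) replaces the surface integral,
so no dimension needs separate treatment. -/

namespace HarmonicMap

open MeasureTheory Metric Filter Topology

/-! ### Differentiating scaled ball integrals by dilation to the unit ball. -/

section Dilation

variable {E : Type*} [NormedAddCommGroup E] [NormedSpace ℝ E] [FiniteDimensional ℝ E]
  [MeasurableSpace E] [BorelSpace E] (μ : Measure E) [μ.IsAddHaarMeasure]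

/-- A continuous function is integrable on balls. -/
theorem integrableOn_ball_of_continuous {f : E → ℝ} (hf : Continuous f) (x : E) (r : ℝ) :
    IntegrableOn f (ball x r) μ :=
  (hf.continuousOn.integrableOn_compact (isCompact_closedBall x r)).mono_set ball_subset_closedBall

/-- Rescaling an integral over `B_r(x)` to the unit ball. -/
theorem integral_unitBall_dilation (f : E → ℝ) (x : E) {r : ℝ} (hr : 0 < r) :
    ∫ z in ball (0 : E) 1, f (x + r • z) ∂μ
      = (r ^ Module.finrank ℝ E)⁻¹ * ∫ y in ball x r, f y ∂μ := by
  rw [Measure.setIntegral_comp_smul_of_pos μ (fun y => f (x + y)) _ hr, smul_eq_mul,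
    smul_unitBall_of_pos hr]
  congr 1
  have h := (measurePreserving_add_left μ x).setIntegral_preimage_emb
    (measurableEmbedding_addLeft x) f (ball x r)
  rw [← h]
  simp

/-- Differentiation of the integral over the unit ball of the dilates of a `C¹` function. -/
theorem hasDerivAt_integral_unitBall_dilation {f : E → ℝ} (hf : ContDiff ℝ 1 f) (x : E) (r : ℝ) :
    HasDerivAt (fun s : ℝ => ∫ z in ball (0 : E) 1, f (x + s • z) ∂μ)
      (∫ z in ball (0 : E) 1, fderiv ℝ f (x + r • z) z ∂μ) r := by
  have hc : Continuous fun p : ℝ × E => fderiv ℝ f (x + p.1 • p.2) p.2 :=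
    ((hf.continuous_fderiv one_ne_zero).comp (by fun_prop)).clm_apply continuous_snd
  -- Compactness bounds the `s`-derivative uniformly for `|s - r| ≤ 1` and `z` in the unit ball; the
  -- constant `C` is the dominating function.
  obtain ⟨C, hC⟩ := ((isCompact_closedBall r 1).prod
    (isCompact_closedBall (0 : E) 1)).exists_bound_of_continuousOn hc.continuousOn
  have hcont (s : ℝ) : Continuous fun z : E => f (x + s • z) := hf.continuous.comp (by fun_prop)
  refine (hasDerivAt_integral_of_dominated_loc_of_deriv_le
    (F := fun s z => f (x + s • z)) (F' := fun s z => fderiv ℝ f (x + s • z) z)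
    (bound := fun _ => C) (ball_mem_nhds r one_pos)
    (Eventually.of_forall fun s => (hcont s).aestronglyMeasurable)
    (integrableOn_ball_of_continuous μ (hcont r) 0 1)
    (hc.comp (by fun_prop : Continuous fun z : E => (r, z))).aestronglyMeasurable ?_
    (integrableOn_ball_of_continuous μ continuous_const 0 1)
    (Eventually.of_forall fun z s _ => ?_)).2
  · filter_upwards [ae_restrict_mem measurableSet_ball] with z hz s hs
    exact hC (s, z) ⟨ball_subset_closedBall hs, ball_subset_closedBall hz⟩
  · have h1 : HasDerivAt (fun s : ℝ => x + s • z) z s := by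
      simpa using ((hasDerivAt_id s).smul_const z).const_add x
    exact ((hf.differentiable one_ne_zero) _).hasFDerivAt.comp_hasDerivAt s h1

/-- The derivative of `r ↦ r^{-(d-2)} ∫_{B_r(x)} f` in dimension `d`. -/
theorem hasDerivAt_scaled_integral_ball {f : E → ℝ} (hf : ContDiff ℝ 1 f) (x : E) {r : ℝ}
    (hr : 0 < r) :
    HasDerivAt (fun s : ℝ => 1 / s ^ ((Module.finrank ℝ E : ℤ) - 2) * ∫ y in ball x s, f y ∂μ)
      (r * (r ^ Module.finrank ℝ E)⁻¹ *
        ∫ y in ball x r, (2 * f y + fderiv ℝ f y (y - x)) ∂μ) r := by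
  have hcf : Continuous fun y => fderiv ℝ f y (y - x) :=
    (hf.continuous_fderiv one_ne_zero).clm_apply (by fun_prop)
  -- In dimension `d`, `s^{-(d-2)} ∫_{B_s(x)} f = s² ∫_{B_1} f(x + sz) dz`, so the product rule
  -- applies on a fixed domain.
  have hmain := (hasDerivAt_pow 2 r).mul (hasDerivAt_integral_unitBall_dilation μ hf x r)
  have hval : ((2 : ℕ) : ℝ) * r ^ (2 - 1) * (∫ z in ball (0 : E) 1, f (x + r • z) ∂μ)
      + r ^ 2 * (∫ z in ball (0 : E) 1, fderiv ℝ f (x + r • z) z ∂μ)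
      = r * (r ^ Module.finrank ℝ E)⁻¹ *
        ∫ y in ball x r, (2 * f y + fderiv ℝ f y (y - x)) ∂μ := by
    have h1 := integral_unitBall_dilation μ (fun y => fderiv ℝ f y (y - x)) x hr
    have h2 : ∀ z : E, fderiv ℝ f (x + r • z) (x + r • z - x)
        = r * fderiv ℝ f (x + r • z) z := fun z => by simp
    simp only [h2, integral_const_mul] at h1
    rw [integral_add ((integrableOn_ball_of_continuous μ hf.continuous x r).const_mul 2)
      (integrableOn_ball_of_continuous μ hcf x r), integral_const_mul, mul_add, mul_assoc r,
      mul_assoc r, ← h1, integral_unitBall_dilation μ f x hr]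
    push_cast
    ring
  rw [← hval]
  refine hmain.congr_of_eventuallyEq ?_
  filter_upwards [lt_mem_nhds hr] with s hs
  rw [Pi.mul_apply, integral_unitBall_dilation μ f x hs, zpow_sub₀ hs.ne', zpow_natCast, ← mul_assoc]
  congr 1
  have : s ^ Module.finrank ℝ E ≠ 0 := pow_ne_zero _ hs.ne'
  field_simp

end Dilation

/-! ### Sign of the integrated divergence, by radial cutoffs. -/

section Divergence

variable {n : ℕ}

/-- A smooth radial function which is `1` well inside `B_r(x)` and vanishes outside `B_r(x)`. -/
noncomputable def ballCutoff (x : Euc n) (r c : ℝ) (y : Euc n) : ℝ :=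
  Real.smoothTransition (c * (r ^ 2 - ‖y - x‖ ^ 2))

theorem contDiff_ballCutoff (x : Euc n) (r c : ℝ) : ContDiff ℝ 1 (ballCutoff x r c) := by
  refine Real.smoothTransition.contDiff.comp (contDiff_const.mul (contDiff_const.sub ?_))
  exact (contDiff_id.sub contDiff_const).norm_sq ℝ

theorem ballCutoff_eq_zero {x : Euc n} {r c : ℝ} (hr : 0 < r) (hc : 0 ≤ c) {y : Euc n}
    (hy : y ∉ ball x r) : ballCutoff x r c y = 0 := by
  rw [mem_ball, dist_eq_norm, not_lt] at hy
  exact Real.smoothTransition.zero_of_nonpos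
    (mul_nonpos_of_nonneg_of_nonpos hc (by nlinarith))

theorem hasCompactSupport_ballCutoff (x : Euc n) {r c : ℝ} (hr : 0 < r) (hc : 0 ≤ c) :
    HasCompactSupport (ballCutoff x r c) :=
  HasCompactSupport.intro (isCompact_closedBall x r) fun _ hy =>
    ballCutoff_eq_zero hr hc fun h => hy (ball_subset_closedBall h)

/-- The cutoff is radial, so its gradient is a multiple of `y - x`. For `c ≥ 0` the factor is
nonpositive because `Real.smoothTransition` is monotone; this fixes the sign after integration by
parts. -/
theorem fderiv_ballCutoff (x : Euc n) (r c : ℝ) (y v : Euc n) :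
    fderiv ℝ (ballCutoff x r c) y v
      = -(2 * c * deriv Real.smoothTransition (c * (r ^ 2 - ‖y - x‖ ^ 2))) * inner ℝ (y - x) v := by
  have h1 : HasFDerivAt (fun y : Euc n => c * (r ^ 2 - ‖y - x‖ ^ 2))
      _ y :=
    ((((hasFDerivAt_id y).sub_const x).norm_sq).const_sub (r ^ 2)).const_mul c
  have h2 : DifferentiableAt ℝ Real.smoothTransition (c * (r ^ 2 - ‖y - x‖ ^ 2)) :=
    (Real.smoothTransition.contDiff (n := 1)).differentiable one_ne_zero _
  have h3 := h2.hasDerivAt.comp_hasFDerivAt y h1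
  have h4 : HasFDerivAt (ballCutoff x r c) _ y := h3
  rw [h4.fderiv]
  simp [inner_sub_left]
  ring

/-- The divergence of a `C¹` vector field whose radial component with respect to `x` is nonnegative
has nonnegative integral against the radial cutoff functions around `x`. -/
theorem integral_ballCutoff_mul_divergence_nonneg {W : Fin n → Euc n → ℝ}
    (hW : ∀ i, ContDiff ℝ 1 (W i)) {x : Euc n} (hrad : ∀ y, 0 ≤ ∑ i, W i y * (y - x) i)
    {r c : ℝ} (hr : 0 < r) (hc : 0 ≤ c) :
    0 ≤ ∫ y, ballCutoff x r c y * ∑ i, fderiv ℝ (W i) y (stdVec i) := by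
  have hη := contDiff_ballCutoff x r c
  have hs := hasCompactSupport_ballCutoff x hr hc
  have hcη (i : Fin n) : Continuous fun y => fderiv ℝ (ballCutoff x r c) y (stdVec i) :=
    (hη.continuous_fderiv one_ne_zero).clm_apply continuous_const
  have hcW (i : Fin n) : Continuous fun y => fderiv ℝ (W i) y (stdVec i) :=
    ((hW i).continuous_fderiv one_ne_zero).clm_apply continuous_const
  have hi1 (i : Fin n) : Integrable fun y => ballCutoff x r c y * fderiv ℝ (W i) y (stdVec i) :=
    (hη.continuous.mul (hcW i)).integrable_of_hasCompactSupport hs.mul_right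
  have hi2 (i : Fin n) : Integrable fun y => fderiv ℝ (ballCutoff x r c) y (stdVec i) * W i y :=
    ((hcη i).mul (hW i).continuous).integrable_of_hasCompactSupport
      (hs.fderiv_apply ℝ _).mul_right
  have hi3 (i : Fin n) : Integrable fun y => ballCutoff x r c y * W i y :=
    (hη.continuous.mul (hW i).continuous).integrable_of_hasCompactSupport hs.mul_right
  -- Integration by parts has no boundary term because the cutoff has compact support.
  have hparts (i : Fin n) : ∫ y, ballCutoff x r c y * fderiv ℝ (W i) y (stdVec i)
      = ∫ y, -(fderiv ℝ (ballCutoff x r c) y (stdVec i) * W i y) := by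
    rw [integral_neg]
    exact integral_mul_fderiv_eq_neg_fderiv_mul_of_integrable (hi2 i) (hi1 i) (hi3 i)
      (fun y _ => hη.differentiable one_ne_zero y)
      (fun y _ => (hW i).differentiable one_ne_zero y)
  simp only [Finset.mul_sum]
  rw [integral_finsetSum _ fun i _ => hi1 i]
  simp only [hparts]
  rw [← integral_finsetSum (f := fun i y => -(fderiv ℝ (ballCutoff x r c) y (stdVec i) * W i y))
    _ fun i _ => (hi2 i).neg]
  refine integral_nonneg fun y => ?_
  have key : ∑ i, -(fderiv ℝ (ballCutoff x r c) y (stdVec i) * W i y)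
      = 2 * c * deriv Real.smoothTransition (c * (r ^ 2 - ‖y - x‖ ^ 2))
        * ∑ i, W i y * (y - x) i := by
    rw [Finset.mul_sum]
    refine Finset.sum_congr rfl fun i _ => ?_
    rw [fderiv_ballCutoff, EuclideanSpace.inner_single_right]
    simp
    ring
  rw [Pi.zero_apply, key]
  exact mul_nonneg (mul_nonneg (by positivity) Real.smoothTransition.monotone.deriv_nonneg) (hrad y)

/-- The divergence of a `C¹` vector field whose radial component with respect to `x` is nonnegative
has nonnegative integral over every ball around `x`. -/
theorem integral_ball_divergence_nonneg {W : Fin n → Euc n → ℝ}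
    (hW : ∀ i, ContDiff ℝ 1 (W i)) {x : Euc n} (hrad : ∀ y, 0 ≤ ∑ i, W i y * (y - x) i)
    {r : ℝ} (hr : 0 < r) :
    0 ≤ ∫ y in ball x r, ∑ i, fderiv ℝ (W i) y (stdVec i) := by
  set D : Euc n → ℝ := fun y => ∑ i, fderiv ℝ (W i) y (stdVec i) with hD
  have hcD : Continuous D := continuous_finsetSum _ fun i _ =>
    ((hW i).continuous_fderiv one_ne_zero).clm_apply continuous_const
  rw [← integral_indicator measurableSet_ball]
  -- With `c = k → ∞` the cutoffs tend pointwise to the indicator of the open ball, and the products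
  -- are dominated by `‖D‖` on that ball.
  refine ge_of_tendsto' (tendsto_integral_of_dominated_convergence
    (F := fun (k : ℕ) y => ballCutoff x r k y * D y)
    ((ball x r).indicator fun y => ‖D y‖) (fun k => ?_) ?_ (fun k => ?_) ?_)
    (fun k : ℕ => integral_ballCutoff_mul_divergence_nonneg hW hrad hr (Nat.cast_nonneg k))
  · exact ((contDiff_ballCutoff x r k).continuous.mul hcD).aestronglyMeasurable
  · exact (integrable_indicator_iff measurableSet_ball).2
      (integrableOn_ball_of_continuous _ hcD.norm x r)
  · refine Eventually.of_forall fun y => ?_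
    by_cases hy : y ∈ ball x r
    · rw [Set.indicator_of_mem hy, norm_mul]
      refine mul_le_of_le_one_left (norm_nonneg _) ?_
      rw [Real.norm_eq_abs, ballCutoff, abs_of_nonneg (Real.smoothTransition.nonneg _)]
      exact Real.smoothTransition.le_one _
    · rw [Set.indicator_of_notMem hy, ballCutoff_eq_zero hr (Nat.cast_nonneg k) hy]
      simp
  · refine Eventually.of_forall fun y => ?_
    by_cases hy : y ∈ ball x r
    · rw [Set.indicator_of_mem hy]
      have hpos : 0 < r ^ 2 - ‖y - x‖ ^ 2 := by
        rw [mem_ball, dist_eq_norm] at hy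
        nlinarith [norm_nonneg (y - x)]
      -- At a fixed interior point `k (r² - ‖y - x‖²) ≥ 1` for large `k`, where the transition
      -- function is exactly `1`.
      refine tendsto_const_nhds.congr' ?_
      filter_upwards [(tendsto_natCast_atTop_atTop.atTop_mul_const hpos).eventually_ge_atTop 1]
        with k hk
      rw [ballCutoff, Real.smoothTransition.one_of_one_le hk, one_mul]
    · rw [Set.indicator_of_notMem hy]
      refine tendsto_const_nhds.congr fun k => ?_
      rw [ballCutoff_eq_zero hr (Nat.cast_nonneg k) hy, zero_mul]

end Divergence

end HarmonicMap

/-! ### The metric in charts of the target: smoothness and invertibility. -/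

namespace HarmonicMap

open Filter Topology Bundle

/-- Constant vector fields on a normed space are smooth. -/
theorem contMDiff_constantVectorField {E : Type*} [NormedAddCommGroup E] [NormedSpace ℝ E]
    (v : E) : ContMDiff 𝓘(ℝ, E) 𝓘(ℝ, E).tangent ∞
      (fun w : E => (⟨w, v⟩ : TangentBundle 𝓘(ℝ, E) E)) := fun _ =>
  contMDiffAt_vectorSpace_iff_contDiffAt.2 contDiffAt_const

section Target

variable {m : ℕ} {N : Type*} [TopologicalSpace N] [ChartedSpace (Euc m) N]
  [IsManifold (𝓡 m) ∞ N]

theorem contMDiffAt_extChartAt_symm_target (y : N) {u : Euc m}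
    (hu : u ∈ (extChartAt (𝓡 m) y).target) :
    ContMDiffAt 𝓘(ℝ, Euc m) (𝓡 m) ∞ (extChartAt (𝓡 m) y).symm u :=
  (contMDiffOn_extChartAt_symm y).contMDiffAt ((isOpen_extChartAt_target y).mem_nhds hu)

/-- The coordinate vector fields are smooth. -/
theorem contMDiffAt_coordVec (y : N) (i : Fin m) {u : Euc m}
    (hu : u ∈ (extChartAt (𝓡 m) y).target) :
    ContMDiffAt 𝓘(ℝ, Euc m) (𝓡 m).tangent ∞
      (fun w => TotalSpace.mk' (Euc m) ((extChartAt (𝓡 m) y).symm w) (coordVec y w i)) u := by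
  have hopen := isOpen_extChartAt_target (I := 𝓡 m) y
  -- The coordinate field is the tangent map of the inverse chart applied to a constant vector
  -- field.
  have h1 := (contMDiffOn_extChartAt_symm (I := 𝓡 m) (n := ∞) y).contMDiffOn_tangentMapWithin
    (m := ∞) (by simp) hopen.uniqueMDiffOn
  have h2 : ContMDiffAt 𝓘(ℝ, Euc m) 𝓘(ℝ, Euc m).tangent ∞
      (fun w => (⟨w, stdVec i⟩ : TangentBundle 𝓘(ℝ, Euc m) (Euc m))) u :=
    contMDiff_constantVectorField (stdVec i : Euc m) u
  have h3 := ContMDiffWithinAt.comp (s := (extChartAt (𝓡 m) y).target) u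
    (h1 ⟨u, stdVec i⟩ hu) h2.contMDiffWithinAt (fun w hw => hw)
  replace h3 := h3.contMDiffAt (hopen.mem_nhds hu)
  refine h3.congr_of_eventuallyEq ?_
  filter_upwards [hopen.mem_nhds hu] with w hw
  simp only [Function.comp, tangentMapWithin, coordVec, mfderivWithin_of_isOpen hopen hw]

/-- The components of the metric in a chart are smooth. -/
theorem contDiffAt_metricMatrix (g : SmoothMetric m N) (y : N) (i j : Fin m) {u : Euc m}
    (hu : u ∈ (extChartAt (𝓡 m) y).target) :
    ContDiffAt ℝ ∞ (fun w => metricMatrix g y w i j) u := by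
  have h : ContMDiffAt 𝓘(ℝ, Euc m) ((𝓡 m).prod 𝓘(ℝ)) ∞
      (fun w ↦ TotalSpace.mk' ℝ (E := Bundle.Trivial N ℝ) ((extChartAt (𝓡 m) y).symm w)
        (g.inner ((extChartAt (𝓡 m) y).symm w) (coordVec y w i) (coordVec y w j))) u := by
    apply ContMDiffAt.clm_bundle_apply₂ (F₁ := Euc m) (F₂ := Euc m)
    · exact g.contMDiff.contMDiffAt.comp u (contMDiffAt_extChartAt_symm_target y hu)
    · exact contMDiffAt_coordVec y i hu
    · exact contMDiffAt_coordVec y j hu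
  rw [contMDiffAt_totalSpace] at h
  exact h.2.contDiffAt

theorem metricMatrix_symm (g : SmoothMetric m N) (y : N) (u : Euc m) (i j : Fin m) :
    metricMatrix g y u i j = metricMatrix g y u j i :=
  g.symm _ _ _

/-- The metric at a point, applied to components in the preferred chart at another point. -/
theorem inner_coordVec_sum (g : SmoothMetric m N) (y : N) (u v w : Euc m) :
    g.inner ((extChartAt (𝓡 m) y).symm u)
      (mfderiv 𝓘(ℝ, Euc m) (𝓡 m) (extChartAt (𝓡 m) y).symm u v)
      (mfderiv 𝓘(ℝ, Euc m) (𝓡 m) (extChartAt (𝓡 m) y).symm u w)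
      = ∑ a, ∑ b, metricMatrix g y u a b * v a * w b := by
  have hexp (v : Euc m) : mfderiv 𝓘(ℝ, Euc m) (𝓡 m) (extChartAt (𝓡 m) y).symm u v
      = ∑ a, v a • coordVec y u a := by
    have hv : v = ∑ a, v a • (stdVec a : Euc m) := by
      simpa using ((EuclideanSpace.basisFun (Fin m) ℝ).sum_repr v).symm
    conv_lhs => rw [hv]
    refine (map_sum (mfderiv 𝓘(ℝ, Euc m) (𝓡 m) (extChartAt (𝓡 m) y).symm u) _ _).trans ?_
    refine Finset.sum_congr rfl fun a _ => ?_
    exact map_smul (mfderiv 𝓘(ℝ, Euc m) (𝓡 m) (extChartAt (𝓡 m) y).symm u) _ _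
  rw [hexp v, hexp w, map_sum, Finset.sum_comm]
  refine Finset.sum_congr rfl fun b _ => ?_
  rw [map_smul, map_sum, sum_apply, Finset.smul_sum]
  refine Finset.sum_congr rfl fun a _ => ?_
  rw [map_smul, smul_apply]
  simp only [smul_eq_mul, metricMatrix, Matrix.of_apply]
  ring

/-- The components of the metric in the preferred chart at `y` form an invertible matrix at `y`. -/
theorem isUnit_det_metricMatrix (g : SmoothMetric m N) (y : N) {u : Euc m}
    (hu : u ∈ (extChartAt (𝓡 m) y).target) :
    IsUnit (metricMatrix g y u).det := by
  rw [isUnit_iff_ne_zero]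
  -- A kernel vector of the matrix would give a tangent vector of zero length, nonzero because the
  -- differential of the inverse chart is injective.
  intro hdet
  obtain ⟨v, hv, hv0⟩ := Matrix.exists_mulVec_eq_zero_iff.2 hdet
  have hinj : mfderiv 𝓘(ℝ, Euc m) (𝓡 m) (extChartAt (𝓡 m) y).symm u (WithLp.toLp 2 v) ≠ 0 := by
    intro h0
    have h1 := mfderiv_extChartAt_comp_mfderivWithin_extChartAt_symm (I := 𝓡 m) (x := y) hu
    rw [ModelWithCorners.range_eq_univ, mfderivWithin_univ] at h1
    have h2 := DFunLike.congr_fun h1 (WithLp.toLp 2 v)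
    have h3 : (0 : Euc m) = WithLp.toLp 2 v := by
      refine Eq.trans ?_ h2
      exact ((congrArg (mfderiv (𝓡 m) 𝓘(ℝ, Euc m) (extChartAt (𝓡 m) y)
        ((extChartAt (𝓡 m) y).symm u)) h0).trans (ContinuousLinearMap.map_zero _)).symm
    exact hv ((WithLp.toLp_eq_zero 2).1 h3.symm)
  have hpos := g.pos _ _ hinj
  rw [inner_coordVec_sum] at hpos
  have : ∑ a, ∑ b, metricMatrix g y u a b * v a * v b = ∑ a, v a * (metricMatrix g y u).mulVec v a := by
    refine Finset.sum_congr rfl fun a _ => ?_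
    rw [Matrix.mulVec, dotProduct, Finset.mul_sum]
    exact Finset.sum_congr rfl fun b _ => by ring
  simp [this, hv0] at hpos

end Target

end HarmonicMap

/-! ### Index algebra of the conservation law. -/

namespace HarmonicMap

open Filter Topology

section Algebra

variable {n m : ℕ}

/-- The pointwise algebra of the conservation law for the stress-energy tensor: `G` and `dG` are
the metric and its derivatives, `D` and `H` the first and second derivatives of the map, and `dV`
the derivatives of the potential. -/
theorem divergence_stress_algebra (G : Fin m → Fin m → ℝ) (dG : Fin m → Fin m → Fin m → ℝ)
    (D : Fin n → Fin m → ℝ) (H : Fin n → Fin n → Fin m → ℝ) (dV : Fin m → ℝ)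
    (hG : ∀ a b, G a b = G b a)
    (hH : ∀ i j a, H i j a = H j i a)
    (heq : ∀ b, ∑ k, G b k * ∑ i, H i i k +
      ∑ i, ∑ a, ∑ c, 1 / 2 * (dG a c b + dG c a b - dG b a c) * D i a * D i c = -dV b)
    (j : Fin n) :
    1 / 2 * (∑ i, ∑ a, ∑ b, ((∑ c, dG c a b * D j c) * D i a * D i b
        + G a b * (H j i a * D i b + D i a * H j i b))) - ∑ b, dV b * D j b
      = ∑ i, ∑ a, ∑ b, ((∑ c, dG c a b * D i c) * D i a * D j b
        + G a b * (H i i a * D j b + D i a * H i j b)) := by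
  -- This is the equation with lowered index, contracted with `∂_j φ`.
  have hV : -∑ b, dV b * D j b = ∑ i, (∑ a, ∑ b, G a b * (H i i a * D j b)
      + ∑ b, ∑ a, ∑ c, 1 / 2 * (dG a c b + dG c a b - dG b a c) * D i a * D i c * D j b) := by
    rw [← Finset.sum_neg_distrib, Finset.sum_add_distrib]
    simp only [← neg_mul, ← heq, add_mul, Finset.sum_add_distrib]
    congr 1
    · simp only [Finset.mul_sum, Finset.sum_mul]
      rw [Finset.sum_comm]
      simp only [Finset.sum_comm (s := Finset.univ (α := Fin n)) (t := Finset.univ (α := Fin m))]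
      refine Finset.sum_congr rfl fun a _ => Finset.sum_congr rfl fun b _ =>
        Finset.sum_congr rfl fun i _ => ?_
      rw [hG b a]
      ring
    · simp only [Finset.sum_mul]
      rw [Finset.sum_comm]
  rw [sub_eq_add_neg, hV, Finset.mul_sum, ← Finset.sum_add_distrib]
  refine Finset.sum_congr rfl fun i _ => ?_
  -- The two second-derivative terms agree by symmetry of `G` and `H`, which absorbs the factor `½`
  -- of the energy.
  have h1 : ∑ a, ∑ b, G a b * (H j i a * D i b + D i a * H j i b)
      = 2 * ∑ a, ∑ b, G a b * (D i a * H i j b) := by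
    have h2 : ∑ a, ∑ b, G a b * (H j i a * D i b) = ∑ a, ∑ b, G a b * (D i a * H i j b) := by
      rw [Finset.sum_comm]
      refine Finset.sum_congr rfl fun a _ => Finset.sum_congr rfl fun b _ => ?_
      rw [hG b a, hH j i]
      ring
    simp only [mul_add, Finset.sum_add_distrib]
    rw [h2]
    simp only [hH j i]
    rw [← two_mul]
  -- The negative Christoffel term cancels the derivative of the metric inside the energy.
  have hA : ∑ b, ∑ a, ∑ c, dG b a c * D i a * D i c * D j b
      = ∑ a, ∑ b, (∑ c, dG c a b * D j c) * D i a * D i b := by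
    simp only [Finset.sum_mul]
    rw [Finset.sum_comm]
    refine Finset.sum_congr rfl fun a _ => ?_
    rw [Finset.sum_comm]
    exact Finset.sum_congr rfl fun b _ => Finset.sum_congr rfl fun c _ => by ring
  have hS1 : ∑ b, ∑ a, ∑ c, dG c a b * D i a * D i c * D j b
      = ∑ a, ∑ b, (∑ c, dG c a b * D i c) * D i a * D j b := by
    simp only [Finset.sum_mul]
    rw [Finset.sum_comm]
    exact Finset.sum_congr rfl fun a _ => Finset.sum_congr rfl fun b _ =>
      Finset.sum_congr rfl fun c _ => by ring
  -- The two positive Christoffel terms agree after exchanging `a` and `c`; with the factor `½` they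
  -- form the metric derivative in the divergence of `T`.
  have hS2 : ∑ b, ∑ a, ∑ c, dG a c b * D i a * D i c * D j b
      = ∑ b, ∑ a, ∑ c, dG c a b * D i a * D i c * D j b := by
    refine Finset.sum_congr rfl fun b _ => ?_
    rw [Finset.sum_comm]
    exact Finset.sum_congr rfl fun a _ => Finset.sum_congr rfl fun c _ => by ring
  have hC : ∑ b, ∑ a, ∑ c, 1 / 2 * (dG a c b + dG c a b - dG b a c) * D i a * D i c * D j b
      = 1 / 2 * (∑ b, ∑ a, ∑ c, dG a c b * D i a * D i c * D j b
        + ∑ b, ∑ a, ∑ c, dG c a b * D i a * D i c * D j b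
        - ∑ b, ∑ a, ∑ c, dG b a c * D i a * D i c * D j b) := by
    simp only [Finset.mul_sum, ← Finset.sum_add_distrib, ← Finset.sum_sub_distrib]
    exact Finset.sum_congr rfl fun a _ => Finset.sum_congr rfl fun b _ =>
      Finset.sum_congr rfl fun c _ => by ring
  rw [hC, hS2, hS1, hA]
  simp only [Finset.sum_add_distrib, h1]
  simp only [mul_add, Finset.sum_add_distrib]
  ring

end Algebra

/-! ### Componentwise calculus for maps between Euclidean spaces. -/

section Calculus

variable {n m : ℕ}

theorem fderiv_euclidean_component {u : Euc n → Euc m} {x : Euc n} (hu : DifferentiableAt ℝ u x)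
    (a : Fin m) (v : Euc n) : fderiv ℝ (fun z => u z a) x v = fderiv ℝ u x v a := by
  have h : HasFDerivAt (fun z => u z a) _ x :=
    (EuclideanSpace.proj (𝕜 := ℝ) a : Euc m →L[ℝ] ℝ).hasFDerivAt.comp x hu.hasFDerivAt
  rw [h.fderiv]
  rfl

/-- The chain rule in components. -/
theorem fderiv_comp_components {F : Euc m → ℝ} {u : Euc n → Euc m} {x : Euc n}
    (hF : DifferentiableAt ℝ F (u x)) (hu : DifferentiableAt ℝ u x) (v : Euc n) :
    fderiv ℝ (fun z => F (u z)) x v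
      = ∑ c, fderiv ℝ F (u x) (stdVec c) * fderiv ℝ (fun z => u z c) x v := by
  have h1 : fderiv ℝ (fun z => F (u z)) x v = fderiv ℝ F (u x) (fderiv ℝ u x v) := by
    have h : HasFDerivAt (fun z => F (u z)) _ x := hF.hasFDerivAt.comp x hu.hasFDerivAt
    rw [h.fderiv]
    rfl
  have h2 : fderiv ℝ u x v = ∑ c, fderiv ℝ u x v c • (stdVec c : Euc m) := by
    simpa using ((EuclideanSpace.basisFun (Fin m) ℝ).sum_repr (fderiv ℝ u x v)).symm
  rw [h1, h2, map_sum]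
  refine Finset.sum_congr rfl fun c _ => ?_
  rw [map_smul, fderiv_euclidean_component hu, smul_eq_mul, mul_comm]

/-- The Laplacian is the sum of the pure second derivatives. -/
theorem laplacian_eq_sum_fderiv_fderiv {f : Euc n → ℝ} {x : Euc n} (hf : ContDiffAt ℝ 2 f x) :
    Laplacian.laplacian f x
      = ∑ i, fderiv ℝ (fun z => fderiv ℝ f z (stdVec i)) x (stdVec i) := by
  rw [InnerProductSpace.laplacian_eq_iteratedFDeriv_orthonormalBasis f
    (EuclideanSpace.basisFun (Fin n) ℝ)]
  refine Finset.sum_congr rfl fun i _ => ?_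
  have hd : DifferentiableAt ℝ (fderiv ℝ f) x :=
    (hf.fderiv_right (m := 1) (by norm_num)).differentiableAt one_ne_zero
  rw [iteratedFDeriv_two_apply, fderiv_clm_apply hd (differentiableAt_const _)]
  simp

/-- Second derivatives are symmetric. -/
theorem fderiv_fderiv_comm {f : Euc n → ℝ} {x : Euc n} (hf : ContDiffAt ℝ 2 f x) (v w : Euc n) :
    fderiv ℝ (fun z => fderiv ℝ f z v) x w = fderiv ℝ (fun z => fderiv ℝ f z w) x v := by
  have hd : DifferentiableAt ℝ (fderiv ℝ f) x :=
    (hf.fderiv_right (m := 1) (by norm_num)).differentiableAt one_ne_zero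
  rw [fderiv_clm_apply hd (differentiableAt_const _), fderiv_clm_apply hd (differentiableAt_const _)]
  simpa using (hf.isSymmSndFDerivAt (by simp)).eq w v

theorem contDiffAt_fderiv_component {u : Euc n → Euc m} {x : Euc n} (hu : ContDiffAt ℝ ∞ u x)
    (a : Fin m) (v : Euc n) : ContDiffAt ℝ ∞ (fun z => fderiv ℝ (fun w => u w a) z v) x :=
  ((contDiffAt_euclidean.1 hu a).fderiv_right (m := ∞) (by simp)).clm_apply contDiffAt_const

/-- The pullback of the bilinear form with components `G` under `u`, in components. -/
noncomputable def pullbackForm (G : Euc m → Matrix (Fin m) (Fin m) ℝ) (u : Euc n → Euc m)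
    (i j : Fin n) (z : Euc n) : ℝ :=
  ∑ a, ∑ b, G (u z) a b * fderiv ℝ (fun w => u w a) z (stdVec i) *
    fderiv ℝ (fun w => u w b) z (stdVec j)

theorem contDiffAt_pullbackForm {G : Euc m → Matrix (Fin m) (Fin m) ℝ} {u : Euc n → Euc m}
    {x : Euc n} (hu : ContDiffAt ℝ ∞ u x)
    (hG : ∀ a b, ContDiffAt ℝ ∞ (fun w => G w a b) (u x)) (i j : Fin n) :
    ContDiffAt ℝ ∞ (pullbackForm G u i j) x := by
  refine ContDiffAt.sum fun a _ => ContDiffAt.sum fun b _ => ?_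
  exact (((hG a b).comp x hu).mul (contDiffAt_fderiv_component hu a _)).mul
    (contDiffAt_fderiv_component hu b _)

theorem fderiv_pullbackForm {G : Euc m → Matrix (Fin m) (Fin m) ℝ} {u : Euc n → Euc m}
    {x : Euc n} (hu : ContDiffAt ℝ ∞ u x)
    (hG : ∀ a b, ContDiffAt ℝ ∞ (fun w => G w a b) (u x)) (i j k : Fin n) :
    fderiv ℝ (pullbackForm G u i j) x (stdVec k)
      = ∑ a, ∑ b, ((∑ c, fderiv ℝ (fun w => G w a b) (u x) (stdVec c)
            * fderiv ℝ (fun w => u w c) x (stdVec k))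
          * fderiv ℝ (fun w => u w a) x (stdVec i) * fderiv ℝ (fun w => u w b) x (stdVec j)
        + G (u x) a b *
          (fderiv ℝ (fun z => fderiv ℝ (fun w => u w a) z (stdVec i)) x (stdVec k)
            * fderiv ℝ (fun w => u w b) x (stdVec j)
          + fderiv ℝ (fun w => u w a) x (stdVec i)
            * fderiv ℝ (fun z => fderiv ℝ (fun w => u w b) z (stdVec j)) x (stdVec k))) := by
  have htop : (∞ : WithTop ℕ∞) ≠ 0 := by simp
  have h1 (a b) : DifferentiableAt ℝ (fun z => G (u z) a b) x :=
    (ContDiffAt.comp x (hG a b) hu).differentiableAt htop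
  have h2 (a i) : DifferentiableAt ℝ (fun z => fderiv ℝ (fun w => u w a) z (stdVec i)) x :=
    (contDiffAt_fderiv_component hu a _).differentiableAt htop
  have h3 (a b) := ((h1 a b).hasFDerivAt.mul (h2 a i).hasFDerivAt).mul (h2 b j).hasFDerivAt
  have h4 : HasFDerivAt (pullbackForm G u i j) _ x :=
    HasFDerivAt.fun_sum fun a _ => HasFDerivAt.fun_sum fun b _ => h3 a b
  rw [h4.fderiv]
  simp only [sum_apply]
  refine Finset.sum_congr rfl fun a _ => Finset.sum_congr rfl fun b _ => ?_
  rw [← fderiv_comp_components ((hG a b).differentiableAt htop) (hu.differentiableAt htop)]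
  simp only [add_apply, smul_apply, smul_eq_mul, Pi.mul_apply]
  ring

end Calculus

end HarmonicMap

/-! ### Stress tensor, conservation law and the radial field. -/

namespace HarmonicMap

open Filter Topology

variable {n m : ℕ} {N : Type*} [TopologicalSpace N] [ChartedSpace (Euc m) N]

theorem eventually_mem_chart_source {φ : Euc n → N} (hφ : ContMDiff (𝓡 n) (𝓡 m) ∞ φ) (x : Euc n) :
    ∀ᶠ z in 𝓝 x, φ z ∈ (extChartAt (𝓡 m) (φ x)).source :=
  hφ.continuous.continuousAt.eventually_mem (extChartAt_source_mem_nhds (φ x))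

variable [IsManifold (𝓡 m) ∞ N]

/-- The components `g(∂_i φ, ∂_j φ)` of the pullback of the metric. -/
noncomputable def pullbackMetric (g : SmoothMetric m N) (φ : Euc n → N) (i j : Fin n)
    (z : Euc n) : ℝ :=
  g.inner (φ z) (mfderiv (𝓡 n) (𝓡 m) φ z (stdVec i)) (mfderiv (𝓡 n) (𝓡 m) φ z (stdVec j))

theorem contDiffAt_localRep {φ : Euc n → N} (hφ : ContMDiff (𝓡 n) (𝓡 m) ∞ φ) (x : Euc n)
    {z : Euc n} (hz : φ z ∈ (extChartAt (𝓡 m) (φ x)).source) :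
    ContDiffAt ℝ ∞ (localRep (m := m) φ x) z := by
  rw [extChartAt_source] at hz
  have h : ContMDiffAt (𝓡 n) 𝓘(ℝ, Euc m) ∞ (localRep (m := m) φ x) z :=
    (contMDiffAt_extChartAt' hz).comp z (hφ z)
  exact h.contDiffAt

/-- The differential of a map in terms of its expression in a chart of the target. -/
theorem mfderiv_eq_coord {φ : Euc n → N} (hφ : ContMDiff (𝓡 n) (𝓡 m) ∞ φ) (x : Euc n)
    {z : Euc n} (hz : φ z ∈ (extChartAt (𝓡 m) (φ x)).source) (v : Euc n) :
    (mfderiv (𝓡 n) (𝓡 m) φ z v : Euc m)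
      = mfderiv 𝓘(ℝ, Euc m) (𝓡 m) (extChartAt (𝓡 m) (φ x)).symm (localRep φ x z)
          (fderiv ℝ (localRep φ x) z v) := by
  have hu := contDiffAt_localRep hφ x hz
  have hev : φ =ᶠ[𝓝 z] (extChartAt (𝓡 m) (φ x)).symm ∘ localRep φ x := by
    filter_upwards [hφ.continuous.continuousAt.eventually_mem
      ((isOpen_extChartAt_source (φ x)).mem_nhds hz)] with w hw
    exact ((extChartAt (𝓡 m) (φ x)).left_inv hw).symm
  have hsymm := contMDiffAt_extChartAt_symm_target (φ x) ((extChartAt (𝓡 m) (φ x)).map_source hz)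
  have h1 : MDifferentiableAt (𝓡 n) 𝓘(ℝ, Euc m) (localRep φ x) z :=
    (hu.differentiableAt (by simp)).mdifferentiableAt
  have h2 := mfderiv_comp (I := 𝓡 n) (I' := 𝓘(ℝ, Euc m)) (I'' := 𝓡 m) z
    (f := localRep φ x) (hsymm.mdifferentiableAt (by simp)) h1
  have h3 := hev.mfderiv_eq (I := 𝓡 n) (I' := 𝓡 m)
  have h4 : (mfderiv (𝓡 n) (𝓡 m) φ z v : Euc m)
      = mfderiv (𝓡 n) (𝓡 m) ((extChartAt (𝓡 m) (φ x)).symm ∘ localRep φ x) z v :=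
    congrArg (fun L : Euc n →L[ℝ] Euc m => L v) h3
  refine h4.trans ?_
  rw [h2, ← mfderiv_eq_fderiv]
  rfl

/-- All tangent spaces are definitionally `Euc m`, so the base point can be replaced while keeping
the same component vectors. -/
theorem inner_congr_point (g : SmoothMetric m N) {p q : N} (h : p = q) (v w : Euc m) :
    g.inner p v w = g.inner q v w := by
  subst h; rfl

/-- The pullback of the metric in terms of the expression of the map in a chart of the target. -/
theorem pullbackMetric_eq_pullbackForm (g : SmoothMetric m N) {φ : Euc n → N}
    (hφ : ContMDiff (𝓡 n) (𝓡 m) ∞ φ) (x : Euc n) {z : Euc n}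
    (hz : φ z ∈ (extChartAt (𝓡 m) (φ x)).source) (i j : Fin n) :
    pullbackMetric g φ i j z
      = pullbackForm (metricMatrix g (φ x)) (localRep φ x) i j z := by
  have hu := (contDiffAt_localRep hφ x hz).differentiableAt (by simp)
  have hp : φ z = (extChartAt (𝓡 m) (φ x)).symm (localRep φ x z) :=
    ((extChartAt (𝓡 m) (φ x)).left_inv hz).symm
  have h1 := (inner_congr_point g hp (mfderiv (𝓡 n) (𝓡 m) φ z (stdVec i))
    (mfderiv (𝓡 n) (𝓡 m) φ z (stdVec j)))
  have h2 := mfderiv_eq_coord hφ x hz (stdVec i)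
  have h3 := mfderiv_eq_coord hφ x hz (stdVec j)
  refine h1.trans ?_
  rw [h2, h3]
  refine (inner_coordVec_sum g (φ x) (localRep φ x z) _ _).trans ?_
  simp only [pullbackForm, fderiv_euclidean_component hu]

/-- Smoothness is local, and near each point `T_ij` is a polynomial in smooth metric components and
first derivatives in one fixed chart. -/
theorem contDiff_pullbackMetric (g : SmoothMetric m N) {φ : Euc n → N}
    (hφ : ContMDiff (𝓡 n) (𝓡 m) ∞ φ) (i j : Fin n) :
    ContDiff ℝ ∞ (pullbackMetric g φ i j) := by
  refine contDiff_iff_contDiffAt.2 fun x => ?_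
  refine (contDiffAt_pullbackForm (contDiffAt_localRep hφ x (mem_extChartAt_source (φ x)))
    (fun a b => contDiffAt_metricMatrix g (φ x) a b (mem_extChartAt_target (φ x)))
    i j).congr_of_eventuallyEq ?_
  filter_upwards [eventually_mem_chart_source hφ x] with z hz
  exact pullbackMetric_eq_pullbackForm g hφ x hz i j

theorem energyDensity_eq (g : SmoothMetric m N) (V : N → ℝ) (φ : Euc n → N) (z : Euc n) :
    energyDensity g V φ z = 1 / 2 * ∑ i, pullbackMetric g φ i i z - V (φ z) := rfl

theorem contDiff_energyDensity (g : SmoothMetric m N) {V : N → ℝ}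
    (hV : ContMDiff (𝓡 m) 𝓘(ℝ, ℝ) ∞ V) {φ : Euc n → N} (hφ : ContMDiff (𝓡 n) (𝓡 m) ∞ φ) :
    ContDiff ℝ ∞ (energyDensity g V φ) :=
  (contDiff_const.mul (ContDiff.sum fun i _ => contDiff_pullbackMetric g hφ i i)).sub
    (contMDiff_iff_contDiff.1 (hV.comp hφ))

/-- The equation for harmonic maps with potential, with lowered index. -/
theorem lowered_equation (g : SmoothMetric m N) {V : N → ℝ} {φ : Euc n → N}
    (hφ : IsHarmonicWithPotential g V φ) (x : Euc n) (b : Fin m) :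
    ∑ k, metricMatrix g (φ x) (localRep φ x x) b k *
        Laplacian.laplacian (fun z => localRep φ x z k) x
      + ∑ i, ∑ a, ∑ c, 1 / 2 * (metricDeriv g (φ x) (localRep φ x x) a c b
          + metricDeriv g (φ x) (localRep φ x x) c a b
          - metricDeriv g (φ x) (localRep φ x x) b a c)
        * fderiv ℝ (fun z => localRep φ x z a) x (stdVec i)
        * fderiv ℝ (fun z => localRep φ x z c) x (stdVec i)
      = -fderiv ℝ (V ∘ (extChartAt (𝓡 m) (φ x)).symm) (localRep φ x x) (stdVec b) := by
  set G := metricMatrix g (φ x) (localRep φ x x) with hG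
  have hunit : IsUnit G.det := isUnit_det_metricMatrix g (φ x) (mem_extChartAt_target (φ x))
  have hinv (f : Fin m → ℝ) : ∑ k, G b k * ∑ l, G⁻¹ k l * f l = f b := by
    have h : G.mulVec (G⁻¹.mulVec f) = f := by
      rw [Matrix.mulVec_mulVec, Matrix.mul_nonsing_inv _ hunit, Matrix.one_mulVec]
    exact congrFun h b
  -- The `k`-th component of the equation: `localRep φ x x` unfolds to the coordinates of `φ x` used
  -- in `tensionField` and `riemGradient`.
  have hk (k : Fin m) : Laplacian.laplacian (fun z => localRep φ x z k) x +
      ∑ i : Fin n, ∑ a : Fin m, ∑ c : Fin m,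
        christoffel g (φ x) (localRep φ x x) k a c *
          fderiv ℝ (fun z => localRep φ x z a) x (stdVec i) *
          fderiv ℝ (fun z => localRep φ x z c) x (stdVec i)
      = -∑ l, G⁻¹ k l *
        fderiv ℝ (V ∘ (extChartAt (𝓡 m) (φ x)).symm) (localRep φ x x) (stdVec l) :=
    congrArg (fun v : Euc m => v k) (hφ.equation x)
  -- Multiplying by `G` cancels the inverse metric and leaves the Christoffel symbols of the first
  -- kind.
  have hΓ (a c : Fin m) : ∑ k, G b k * christoffel g (φ x) (localRep φ x x) k a c
      = 1 / 2 * (metricDeriv g (φ x) (localRep φ x x) a c b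
          + metricDeriv g (φ x) (localRep φ x x) c a b
          - metricDeriv g (φ x) (localRep φ x x) b a c) := by
    rw [← hinv fun l => 1 / 2 * (metricDeriv g (φ x) (localRep φ x x) a c l
          + metricDeriv g (φ x) (localRep φ x x) c a l
          - metricDeriv g (φ x) (localRep φ x x) l a c)]
    refine Finset.sum_congr rfl fun k _ => ?_
    rw [christoffel, Finset.mul_sum]
    exact congrArg _ (Finset.sum_congr rfl fun l _ => by ring)
  have hsum : ∑ k, G b k * ∑ i : Fin n, ∑ a : Fin m, ∑ c : Fin m,
        christoffel g (φ x) (localRep φ x x) k a c *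
          fderiv ℝ (fun z => localRep φ x z a) x (stdVec i) *
          fderiv ℝ (fun z => localRep φ x z c) x (stdVec i)
      = ∑ i, ∑ a, ∑ c, (∑ k, G b k * christoffel g (φ x) (localRep φ x x) k a c)
        * fderiv ℝ (fun z => localRep φ x z a) x (stdVec i)
        * fderiv ℝ (fun z => localRep φ x z c) x (stdVec i) := by
    simp only [Finset.mul_sum, Finset.sum_mul]
    rw [Finset.sum_comm]
    refine Finset.sum_congr rfl fun i _ => ?_
    rw [Finset.sum_comm]
    refine Finset.sum_congr rfl fun a _ => ?_
    rw [Finset.sum_comm]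
    exact Finset.sum_congr rfl fun c _ => Finset.sum_congr rfl fun k _ => by ring
  simp only [← hΓ]
  rw [← hsum, ← Finset.sum_add_distrib]
  simp only [← mul_add, hk, mul_neg, Finset.sum_neg_distrib]
  rw [hinv]

/-- The conservation law for the stress-energy tensor of a harmonic map with potential. -/
theorem fderiv_energyDensity (g : SmoothMetric m N) {V : N → ℝ}
    (hV : ContMDiff (𝓡 m) 𝓘(ℝ, ℝ) ∞ V) {φ : Euc n → N}
    (hφ : IsHarmonicWithPotential g V φ) (x : Euc n) (j : Fin n) :
    fderiv ℝ (energyDensity g V φ) x (stdVec j)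
      = ∑ i, fderiv ℝ (pullbackMetric g φ i j) x (stdVec i) := by
  have htop : (∞ : WithTop ℕ∞) ≠ 0 := by simp
  have hu := contDiffAt_localRep hφ.smooth x (mem_extChartAt_source (φ x))
  have hu2 (a : Fin m) : ContDiffAt ℝ 2 (fun z => localRep φ x z a) x :=
    contDiffAt_infty.1 (contDiffAt_euclidean.1 hu a) 2
  have hGs (a b) := contDiffAt_metricMatrix g (φ x) a b (mem_extChartAt_target (φ x))
  have hVs : ContDiffAt ℝ ∞ (V ∘ (extChartAt (𝓡 m) (φ x)).symm) (localRep φ x x) :=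
    ((hV _).comp _ (contMDiffAt_extChartAt_symm_target (φ x)
      (mem_extChartAt_target (φ x)))).contDiffAt
  have hev (i j : Fin n) : pullbackMetric g φ i j
      =ᶠ[𝓝 x] pullbackForm (metricMatrix g (φ x)) (localRep φ x) i j := by
    filter_upwards [eventually_mem_chart_source hφ.smooth x] with z hz
    exact pullbackMetric_eq_pullbackForm g hφ.smooth x hz i j
  have hVev : (fun z => V (φ z))
      =ᶠ[𝓝 x] fun z => (V ∘ (extChartAt (𝓡 m) (φ x)).symm) (localRep φ x z) := by
    filter_upwards [eventually_mem_chart_source hφ.smooth x] with z hz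
    exact congrArg V ((extChartAt (𝓡 m) (φ x)).left_inv hz).symm
  have hT (i j : Fin n) : DifferentiableAt ℝ (pullbackMetric g φ i j) x :=
    ((contDiff_pullbackMetric g hφ.smooth i j).differentiable htop) x
  have hVφ : DifferentiableAt ℝ (fun z => V (φ z)) x :=
    ((contMDiff_iff_contDiff.1 (hV.comp hφ.smooth)).differentiable htop) x
  have hD : HasFDerivAt (energyDensity g V φ)
      ((1 / 2 : ℝ) • (∑ i, fderiv ℝ (pullbackMetric g φ i i) x) - fderiv ℝ (fun z => V (φ z)) x) x :=
    ((HasFDerivAt.fun_sum fun i _ => (hT i i).hasFDerivAt).const_mul (1 / 2)).sub hVφ.hasFDerivAt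
  -- All quantities are read in the single chart at `φ x`, valid for all points near `x`.
  have hmain := divergence_stress_algebra
    (fun a b => metricMatrix g (φ x) (localRep φ x x) a b)
    (fun c a b => metricDeriv g (φ x) (localRep φ x x) c a b)
    (fun i a => fderiv ℝ (fun z => localRep φ x z a) x (stdVec i))
    (fun i j a => fderiv ℝ (fun z => fderiv ℝ (fun w => localRep φ x w a) z (stdVec j)) x (stdVec i))
    (fun b => fderiv ℝ (V ∘ (extChartAt (𝓡 m) (φ x)).symm) (localRep φ x x) (stdVec b))
    (fun a b => metricMatrix_symm g (φ x) _ a b)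
    (fun i j a => fderiv_fderiv_comm (hu2 a) _ _)
    (fun b => by
      simp only [← laplacian_eq_sum_fderiv_fderiv (hu2 _)]
      exact lowered_equation g hφ x b) j
  rw [hD.fderiv]
  simp only [sub_apply, smul_apply, sum_apply, smul_eq_mul]
  rw [hVev.fderiv_eq, fderiv_comp_components (hVs.differentiableAt htop) (hu.differentiableAt htop)]
  simp only [(hev _ _).fderiv_eq, fderiv_pullbackForm hu hGs]
  exact hmain

/-- The field `∑_j g(∂_i φ, ∂_j φ) (y - x)_j`, whose divergence governs the growth of the energy. -/
noncomputable def radialStress (g : SmoothMetric m N) (φ : Euc n → N) (x : Euc n) (i : Fin n)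
    (y : Euc n) : ℝ :=
  ∑ j, pullbackMetric g φ i j y * (y - x) j

theorem contDiff_sub_component (x : Euc n) (j : Fin n) : ContDiff ℝ ∞ fun y : Euc n => (y - x) j :=
  contDiff_euclidean.1 (contDiff_id.sub contDiff_const) j

theorem contDiff_radialStress (g : SmoothMetric m N) {φ : Euc n → N}
    (hφ : ContMDiff (𝓡 n) (𝓡 m) ∞ φ) (x : Euc n) (i : Fin n) :
    ContDiff ℝ ∞ (radialStress g φ x i) :=
  ContDiff.sum fun j _ => (contDiff_pullbackMetric g hφ i j).mul (contDiff_sub_component x j)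

/-- Contracting `T` twice with `y - x` gives `g(dφ(y - x), dφ(y - x))`. -/
theorem radialStress_radial_nonneg (g : SmoothMetric m N) (φ : Euc n → N) (x y : Euc n) :
    0 ≤ ∑ i, radialStress g φ x i y * (y - x) i := by
  have h1 : ∑ i, radialStress g φ x i y * (y - x) i
      = g.inner (φ y) (∑ i, (y - x) i • mfderiv (𝓡 n) (𝓡 m) φ y (stdVec i))
        (∑ i, (y - x) i • mfderiv (𝓡 n) (𝓡 m) φ y (stdVec i)) := by
    rw [map_sum]
    refine Finset.sum_congr rfl fun i _ => ?_
    rw [map_smul, map_sum, sum_apply, radialStress, Finset.sum_mul, Finset.smul_sum]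
    refine Finset.sum_congr rfl fun j _ => ?_
    rw [map_smul, smul_apply, pullbackMetric, g.symm]
    simp only [smul_eq_mul]
    ring
  rw [h1]
  rcases eq_or_ne (∑ i, (y - x) i • mfderiv (𝓡 n) (𝓡 m) φ y (stdVec i)) 0 with h | h
  · rw [h, map_zero]
  · exact (g.pos _ _ h).le

/-- By the product rule, derivatives falling on `T` give `de(y - x)` through the conservation law,
and those falling on `y - x` give the trace `|dφ|² = 2e + 2V(φ)`. -/
theorem divergence_radialStress (g : SmoothMetric m N) {V : N → ℝ}
    (hV : ContMDiff (𝓡 m) 𝓘(ℝ, ℝ) ∞ V) {φ : Euc n → N}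
    (hφ : IsHarmonicWithPotential g V φ) (x y : Euc n) :
    ∑ i, fderiv ℝ (radialStress g φ x i) y (stdVec i)
      = 2 * energyDensity g V φ y + fderiv ℝ (energyDensity g V φ) y (y - x) + 2 * V (φ y) := by
  have htop : (∞ : WithTop ℕ∞) ≠ 0 := by simp
  have hT (i j : Fin n) : DifferentiableAt ℝ (pullbackMetric g φ i j) y :=
    ((contDiff_pullbackMetric g hφ.smooth i j).differentiable htop) y
  have hX (j : Fin n) : DifferentiableAt ℝ (fun w : Euc n => (w - x) j) y :=
    ((contDiff_sub_component x j).differentiable htop) y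
  have hXd (i j : Fin n) : fderiv ℝ (fun w : Euc n => (w - x) j) y (stdVec i)
      = if j = i then 1 else 0 := by
    rw [fderiv_euclidean_component (u := fun w => w - x) (by fun_prop)]
    simp [fderiv_sub_const]
  have hd (i : Fin n) : fderiv ℝ (radialStress g φ x i) y (stdVec i)
      = ∑ j, (y - x) j * fderiv ℝ (pullbackMetric g φ i j) y (stdVec i)
        + pullbackMetric g φ i i y := by
    have h : HasFDerivAt (radialStress g φ x i) _ y :=
      HasFDerivAt.fun_sum fun j _ => (hT i j).hasFDerivAt.mul (hX j).hasFDerivAt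
    rw [h.fderiv]
    simp only [sum_apply, add_apply, smul_apply, smul_eq_mul, hXd, mul_ite, mul_one, mul_zero,
      Finset.sum_add_distrib, Finset.sum_ite_eq', Finset.mem_univ, if_true]
    ring
  have hexp : fderiv ℝ (energyDensity g V φ) y (y - x)
      = ∑ j, (y - x) j * fderiv ℝ (energyDensity g V φ) y (stdVec j) := by
    have hv : y - x = ∑ j, (y - x) j • (stdVec j : Euc n) := by
      simpa using ((EuclideanSpace.basisFun (Fin n) ℝ).sum_repr (y - x)).symm
    conv_lhs => rw [hv]
    rw [map_sum]
    exact Finset.sum_congr rfl fun j _ => map_smul _ _ _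
  rw [hexp, energyDensity_eq]
  simp only [hd, Finset.sum_add_distrib, fderiv_energyDensity g hV hφ, Finset.mul_sum]
  rw [Finset.sum_comm]
  simp only [← Finset.mul_sum]
  ring

end HarmonicMap

/-! ### Monotonicity of the scaled energy. -/

open HarmonicMap

theorem mainTheorem7 {n m : ℕ} {N : Type*} [TopologicalSpace N] [ChartedSpace (Euc m) N]
    [IsManifold (𝓡 m) ∞ N] (g : SmoothMetric m N)
    (V : N → ℝ) (hV : ContMDiff (𝓡 m) 𝓘(ℝ, ℝ) ∞ V)
    (φ : Euc n → N) (hφ : HarmonicMap.IsHarmonicWithPotential g V φ)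
    (hVφ : ∀ y, V (φ y) ≤ 0) (x : Euc n) :
    (∀ r : ℝ, 0 < r →
      MeasureTheory.IntegrableOn (HarmonicMap.energyDensity g V φ) (Metric.ball x r) ∧
      DifferentiableAt ℝ (HarmonicMap.scaledEnergy g V φ x) r ∧
      0 ≤ deriv (HarmonicMap.scaledEnergy g V φ x) r) ∧
    MonotoneOn (HarmonicMap.scaledEnergy g V φ x) (Set.Ioi 0) := by
  have he : ContDiff ℝ 1 (energyDensity g V φ) :=
    (contDiff_energyDensity g hV hφ.smooth).of_le (by exact_mod_cast le_top)
  have hVc : Continuous fun y => V (φ y) := hV.continuous.comp hφ.smooth.continuous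
  have hnonneg {r : ℝ} (hr : 0 < r) : 0 ≤ ∫ y in Metric.ball x r,
      (2 * energyDensity g V φ y + fderiv ℝ (energyDensity g V φ) y (y - x)) := by
    have hW (i : Fin n) : ContDiff ℝ 1 (radialStress g φ x i) :=
      (contDiff_radialStress g hφ.smooth x i).of_le (by exact_mod_cast le_top)
    -- The divergence of the radial field exceeds the integrand by `2V(φ)`; here `V(φ) ≤ 0` enters.
    refine (integral_ball_divergence_nonneg hW (radialStress_radial_nonneg g φ x) hr).trans ?_
    have hc : Continuous fun y => 2 * energyDensity g V φ y
        + fderiv ℝ (energyDensity g V φ) y (y - x) :=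
      (continuous_const.mul he.continuous).add
        ((he.continuous_fderiv one_ne_zero).clm_apply (by fun_prop))
    simp only [divergence_radialStress g hV hφ]
    refine MeasureTheory.integral_mono
      (integrableOn_ball_of_continuous _ (hc.add (continuous_const.mul hVc)) x r)
      (integrableOn_ball_of_continuous _ hc x r) fun y => ?_
    linarith [hVφ y]
  have hderiv {r : ℝ} (hr : 0 < r) : HasDerivAt (scaledEnergy g V φ x) (r * (r ^ n)⁻¹ *
      ∫ y in Metric.ball x r,
        (2 * energyDensity g V φ y + fderiv ℝ (energyDensity g V φ) y (y - x))) r := by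
    have h := hasDerivAt_scaled_integral_ball MeasureTheory.volume he x hr
    rw [finrank_euclideanSpace_fin] at h
    exact h
  have hderiv_nonneg {r : ℝ} (hr : 0 < r) : 0 ≤ deriv (scaledEnergy g V φ x) r := by
    rw [(hderiv hr).deriv]
    exact mul_nonneg (by positivity) (hnonneg hr)
  refine ⟨fun r hr => ⟨integrableOn_ball_of_continuous _ he.continuous x r,
    (hderiv hr).differentiableAt, hderiv_nonneg hr⟩, ?_⟩
  refine monotoneOn_of_deriv_nonneg (convex_Ioi 0)
    (fun r hr => (hderiv hr).continuousAt.continuousWithinAt) ?_ ?_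
  · rw [interior_Ioi]
    exact fun r hr => (hderiv hr).differentiableAt.differentiableWithinAt
  · rw [interior_Ioi]
    exact fun r hr => hderiv_nonneg hr
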